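/- Let $m,n\ge 0$ be integers, $[m]=\{1,\dots,m\}$, and let $\mathcal B\subseteq\binom{[m]}{n}$ be any family of $n$-element subsets of $[m]$, with dual family $\mathcal B^\star=\{[m]\setminus S: S\in\mathcal B\}$. For a polynomial $p\in\mathbb R[z_1,\dots,z_m]$ and $S\subseteq[m]$ let $p_S$ be the coefficient of $z^S=\prod_{i\in S}z_i$ in $p$, and let $p_{\mathcal B}=\sum_{S\in\mathcal B}p_S$. The polynomial $p$ is *real stable* if $p(z)\neq 0$ for all $z\in\mathbb C^m$ with $\operatorname{Im} z_i>0$ for every $i$, and *multiaffine* if only square-free monomials $z^S$ occur in it. For a family $\mathcal F$ of subsets of $[m]$ let $P(\mathcal F)=\operatorname{conv}\{1_S:S\in\mathcal F\}\subseteq[0,1]^m$, and for $p$ with nonnegative coefficients put $$\mathrm{Cap}_{\mathcal F}(p)=\sup_{\theta\in P(\mathcal F)}\ \inf_{z>0}\frac{p(z)}{\prod_{i=1}^m z_i^{\theta_i}},\qquad \underline{\mathrm{Cap}}_{\mathcal F}(p)=\inf_{\theta\in P(\mathcal F)}\ \inf_{z>0}\frac{p(z)}{\prod_{i=1}^m z_i^{\theta_i}}$$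 (if $\mathcal F=\emptyset$, both are read as $0$; also $0^0=1$). Let $c\ge 1$. A *$c$-approximate $\mathcal B^\star$-selection* is an $(m-n)$-homogeneous polynomial $h\in\mathbb R[z_1,\dots,z_m]$ with nonnegative coefficients such that, for $S\in\binom{[m]}{m-n}$, $h_S>0$ only if $S\in\mathcal B^\star$, and $h_S\in[1,c]$ for every $S\in\mathcal B^\star$. A *$\mathcal B^\star$-selection* is defined in the same way, with $h_S=1$ for every $S\in\mathcal B^\star$. Let $g\in\mathbb R[z_1,\dots,z_m]$ be a real stable, $n$-homogeneous polynomial with nonnegative coefficients. Then the following hold. 1. $g_{\mathcal B}\le \mathrm{Cap}_{\mathcal B}(g)$. 2. For every real stable $\mathcal B^\star$-selection $h$, $$\mathrm{Cap}_{\mathcal B}(g)\cdot\underline{\mathrm{Cap}}_{\mathcal B^\star}(h)\cdot\frac{m!}{m^m}\ \le\ g_{\mathcal B},$$ and if moreover $g$ and $h$ are both multiaffine, then $\mathrm{Cap}_{\mathcal B}(g)\cdot\underline{\mathrm{Cap}}_{\mathcal B^\star}(h)\cdot 2^{-m}\le g_{\mathcal B}$. 3. For every $c\ge1$ and every real stable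 $c$-approximate $\mathcal B^\star$-selection $h$, $$\frac1c\cdot\mathrm{Cap}_{\mathcal B}(g)\cdot\underline{\mathrm{Cap}}_{\mathcal B^\star}(h)\cdot\frac{m!}{m^m}\ \le\ g_{\mathcal B},$$ and if moreover $g$ and $h$ are both multiaffine, then $\frac1c\cdot\mathrm{Cap}_{\mathcal B}(g)\cdot\underline{\mathrm{Cap}}_{\mathcal B^\star}(h)\cdot 2^{-m}\le g_{\mathcal B}$. -/

import Mathlib

namespace SetCapacity

noncomputable section

/-- A real polynomial with nonnegative coefficients. -/
def NonnegCoeffs {m : ℕ} (p : MvPolynomial (Fin m) ℝ) : Prop :=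
  ∀ α : Fin m →₀ ℕ, 0 ≤ p.coeff α

/-- Real stability: no zero in the product of open upper half-planes
(in particular the zero polynomial is not real stable). -/
def IsRealStable {m : ℕ} (p : MvPolynomial (Fin m) ℝ) : Prop :=
  ∀ z : Fin m → ℂ, (∀ i, 0 < (z i).im) → MvPolynomial.aeval z p ≠ 0

/-- Only square-free monomials occur. -/
def IsMultiaffine {m : ℕ} (p : MvPolynomial (Fin m) ℝ) : Prop :=
  ∀ α ∈ p.support, ∀ i, α i ≤ 1

/-- The coefficient `p_S` of the square-free monomial `∏ i ∈ S, z i`. -/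
def setCoeff {m : ℕ} (p : MvPolynomial (Fin m) ℝ) (S : Finset (Fin m)) : ℝ :=
  p.coeff (∑ i ∈ S, Finsupp.single i 1)

/-- `p_B`, the sum of the coefficients `p_S` over `S ∈ B`. -/
def familyCoeff {m : ℕ} (B : Finset (Finset (Fin m))) (p : MvPolynomial (Fin m) ℝ) : ℝ :=
  ∑ S ∈ B, setCoeff p S

/-- The dual family `B⋆ = {[m] ∖ S : S ∈ B}`. -/
def dualFamily {m : ℕ} (B : Finset (Finset (Fin m))) : Finset (Finset (Fin m)) :=
  B.image (fun S => Sᶜ)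

/-- `P(B)`, the convex hull of the characteristic vectors of the members of `B`. -/
def polytope {m : ℕ} (B : Finset (Finset (Fin m))) : Set (Fin m → ℝ) :=
  convexHull ℝ ((fun S : Finset (Fin m) => fun i : Fin m => if i ∈ S then (1 : ℝ) else 0) ''
    (B : Set (Finset (Fin m))))

/-- `inf_{z > 0} p(z) / ∏ i, z i ^ θ i`. For `p` with nonnegative coefficients this is an infimum
of nonnegative numbers over a nonempty set, and it is at most `p(1, …, 1)`. -/
def capAt {m : ℕ} (p : MvPolynomial (Fin m) ℝ) (θ : Fin m → ℝ) : ℝ :=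
  ⨅ z : {z : Fin m → ℝ // ∀ i, 0 < z i}, MvPolynomial.eval z.1 p / ∏ i, (z.1 i) ^ (θ i)

/-- The `B`-capacity. For `p` with nonnegative coefficients the supremum is over numbers in
`[0, p(1, …, 1)]`; for the empty family the value is `0`, the supremum of `∅` in `[0, ∞]`. -/
def cap {m : ℕ} (B : Finset (Finset (Fin m))) (p : MvPolynomial (Fin m) ℝ) : ℝ :=
  ⨆ θ : polytope B, capAt p θ.1

/-- The lower `B`-capacity. For `p` with nonnegative coefficients and `B` nonempty this is an
infimum of nonnegative numbers over a nonempty set. -/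
def lowerCap {m : ℕ} (B : Finset (Finset (Fin m))) (p : MvPolynomial (Fin m) ℝ) : ℝ :=
  ⨅ θ : polytope B, capAt p θ.1

/-- `h` is a `B`-selection, where `B` is a family of `k`-element sets. -/
structure IsSelection {m : ℕ} (k : ℕ) (B : Finset (Finset (Fin m)))
    (h : MvPolynomial (Fin m) ℝ) : Prop where
  nonneg : NonnegCoeffs h
  homogeneous : h.IsHomogeneous k
  mem_of_pos : ∀ S : Finset (Fin m), S.card = k → 0 < setCoeff h S → S ∈ B
  eq_one : ∀ S ∈ B, setCoeff h S = 1

/-- `h` is a `c`-approximate `B`-selection, where `B` is a family of `k`-element sets. -/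
structure IsApproxSelection {m : ℕ} (c : ℝ) (k : ℕ) (B : Finset (Finset (Fin m)))
    (h : MvPolynomial (Fin m) ℝ) : Prop where
  nonneg : NonnegCoeffs h
  homogeneous : h.IsHomogeneous k
  mem_of_pos : ∀ S : Finset (Fin m), S.card = k → 0 < setCoeff h S → S ∈ B
  mem_Icc : ∀ S ∈ B, setCoeff h S ∈ Set.Icc 1 c

end

end SetCapacity

/-!
Gurvits' capacity method. Capacities are supermultiplicative,
`capAt g θ * capAt h (1 - θ) ≤ capAt (g * h) 1`, and `θ ↦ 1 - θ` maps `P(B)` into `P(B⋆)`, while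
the coefficient of `∏ i, z i` in `g * h` pairs each `g_S` with the coefficient of `h` at the
complement of `S`, so it is at most `c * g_B`. It remains to bound the coefficient of `∏ i, z i` in
a stable homogeneous `p` from below by `capAt p 1`, which is done one variable at a time. Let `q` be
the coefficient of the first variable `t` in `p`. Since `t ↦ p (t, x)` is real-rooted with
nonnegative coefficients for `x > 0`, AM-GM over its roots gives
`(k / (k + 1)) ^ k * capAt p 1 ≤ capAt q 1` when `p` has degree at most `k + 1` in `t`. With `k + 1`
variables left this always holds, and the factors multiply to `m! / m ^ m`; for multiaffine `g` and
`h` the degree in `t` is at most `2`, and each factor is at least `1 / 2`.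

The polynomial `q` is zero or stable: for `z` in the upper half-planes the nonzero roots of
`t ↦ p (t, z)` lie in the lower half-plane, so Gauss-Lucas excludes `q z = 0` unless `t = 0` is a
root or `p (t, z)` is constant in `t`, and in these cases `p (t, Im z) ≤ ‖p (i t, z)‖` does.

The upper bound on `g_B` is weighted AM-GM at the point of `P(B)` with weights `g_S / g_B`.
-/

namespace SetCapacity

theorem nonpos_of_forall_pos_mul_le {a c : ℝ} (h : ∀ t : ℝ, 0 < t → c * t ≤ a) : c ≤ 0 := by
  by_contra! hc
  have ht := h ((|a| + 1) / c) (by positivity)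
  rw [mul_div_cancel₀ _ hc.ne'] at ht
  linarith [le_abs_self a]

theorem multiset_prod_le_pow_card {s : Multiset ℝ} (hs : ∀ a ∈ s, 0 ≤ a) :
    s.prod ≤ (s.sum / s.card) ^ s.card := by
  classical
  rcases eq_or_ne s 0 with rfl | hs0
  · simp
  have hcard : (0 : ℝ) < s.card := by exact_mod_cast Multiset.card_pos.2 hs0
  have hmem : ∀ x ∈ (Finset.univ : Finset s), (0 : ℝ) ≤ x := fun x _ =>
    hs _ (Multiset.coe_mem (x := x))
  have amgm := Real.geom_mean_le_arith_mean Finset.univ (fun _ : s => (1 : ℝ)) (fun x => x)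
    (fun _ _ => zero_le_one) (by simpa using hcard) hmem
  simp only [Real.rpow_one, one_mul, Finset.sum_const, Finset.card_univ, Multiset.card_coe,
    nsmul_eq_mul, mul_one, ← Multiset.prod_eq_prod_coe, ← Multiset.sum_eq_sum_coe] at amgm
  rwa [Real.rpow_inv_le_iff_of_pos (Multiset.prod_nonneg hs)
    (div_nonneg (Multiset.sum_nonneg hs) hcard.le) hcard, Real.rpow_natCast] at amgm

theorem multiset_prod_one_add_le {s : Multiset ℝ} (hs : ∀ a ∈ s, 0 ≤ a) {N : ℕ} (hN : N ≠ 0)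
    (hcard : s.card ≤ N) : (s.map fun a => 1 + a).prod ≤ (1 + s.sum / N) ^ N := by
  let u := s.map (fun a => 1 + a) + Multiset.replicate (N - s.card) 1
  have hu : ∀ a ∈ u, 0 ≤ a := by
    intro a ha
    rcases Multiset.mem_add.1 ha with ha | ha
    · obtain ⟨b, hb, rfl⟩ := Multiset.mem_map.1 ha
      exact add_nonneg zero_le_one (hs b hb)
    · exact (Multiset.eq_of_mem_replicate ha).symm ▸ zero_le_one
  have hu_card : u.card = N := by simp [u, hcard]
  have hu_sum : u.sum / u.card = 1 + s.sum / N := by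
    have : (N : ℝ) ≠ 0 := by exact_mod_cast hN
    have hadd : (s.map fun a => 1 + a).sum = s.card + s.sum := by
      simpa using Multiset.sum_map_add (m := s) (f := fun _ => (1 : ℝ)) (g := fun a => a)
    rw [hu_card, Multiset.sum_add, hadd, Multiset.sum_replicate, nsmul_one, Nat.cast_sub hcard]
    field_simp
    ring
  calc (s.map fun a => 1 + a).prod = u.prod := by simp [u]
    _ ≤ (u.sum / u.card) ^ u.card := multiset_prod_le_pow_card hu
    _ = (1 + s.sum / N) ^ N := by rw [hu_sum, hu_card]

/-- Gurvits' constant `(k / (k + 1)) ^ k`, the factor by which the capacity can drop when a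
variable of degree at most `k + 1` is eliminated; its value at `k = 0` is `0 ^ 0 = 1`. -/
noncomputable def gurvitsConst (k : ℕ) : ℝ := ((k : ℝ) / (k + 1)) ^ k

theorem gurvitsConst_nonneg (k : ℕ) : 0 ≤ gurvitsConst k := by
  unfold gurvitsConst; positivity

theorem gurvitsConst_le_one (k : ℕ) : gurvitsConst k ≤ 1 :=
  pow_le_one₀ (by positivity) ((div_le_one (by positivity)).2 (by linarith))

theorem half_le_gurvitsConst_min_one (k : ℕ) : 1 / 2 ≤ gurvitsConst (min k 1) := by
  rcases Nat.eq_zero_or_pos k with rfl | hk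
  · norm_num [gurvitsConst]
  · rw [min_eq_right (Nat.succ_le_of_lt hk)]
    norm_num [gurvitsConst]

theorem prod_range_gurvitsConst (m : ℕ) :
    ∏ k ∈ Finset.range m, gurvitsConst k = (m.factorial : ℝ) / (m : ℝ) ^ m := by
  induction m with
  | zero => simp
  | succ m ih =>
    rw [Finset.prod_range_succ, ih, gurvitsConst, div_pow, Nat.factorial_succ]
    rcases Nat.eq_zero_or_pos m with rfl | hm
    · simp
    push_cast
    field_simp
    ring

theorem mul_gurvitsConst_le_of_forall_mul_le {C a s : ℝ} {d : ℕ} (ha : 0 < a) (hs : 0 ≤ s)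
    (h : ∀ t : ℝ, 0 < t → C * t ≤ a * (1 + t * s / (d + 1 : ℕ)) ^ (d + 1)) :
    C * gurvitsConst d ≤ a * s := by
  rcases Nat.eq_zero_or_pos d with rfl | hd
  · have hle : C - a * s ≤ 0 := nonpos_of_forall_pos_mul_le (a := a) fun t ht => by
      have := h t ht
      simp only [zero_add, Nat.cast_one, div_one, pow_one] at this
      linarith
    simpa [gurvitsConst] using hle
  rcases hs.eq_or_lt with rfl | hs
  · have hC : C ≤ 0 := nonpos_of_forall_pos_mul_le (a := a) fun t ht => by simpa using h t ht
    simpa using mul_nonpos_of_nonpos_of_nonneg hC (gurvitsConst_nonneg d)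
  -- The bound is tight at the minimum of `(1 + t s / (d + 1)) ^ (d + 1) / t`.
  have hmin := h ((d + 1) / (s * d)) (by positivity)
  have hbase : 1 + ((d : ℝ) + 1) / (s * d) * s / (d + 1 : ℕ) = (d + 1) / d := by
    push_cast
    field_simp
  rw [hbase] at hmin
  calc C * gurvitsConst d
      = C * ((d + 1) / (s * d)) * ((d / (d + 1)) ^ d * (s * d / (d + 1))) := by
        rw [gurvitsConst]; field_simp
    _ ≤ a * ((d + 1) / d) ^ (d + 1) * ((d / (d + 1)) ^ d * (s * d / (d + 1))) := by gcongr
    _ = a * s := by rw [div_pow, div_pow, pow_succ, pow_succ]; field_simp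

section Univariate

open Polynomial

theorem splits_of_forall_aeval_eq_zero_im_eq_zero {R : ℝ[X]}
    (hR : ∀ z : ℂ, aeval z R = 0 → z.im = 0) : R.Splits := by
  refine Splits.of_splits_map (algebraMap ℝ ℂ) (IsAlgClosed.splits _) fun z hz => ⟨z.re, ?_⟩
  have hz0 : aeval z R = 0 := by
    rw [← eval_map_algebraMap]
    exact (mem_roots'.1 hz).2
  exact Complex.ext rfl (hR z hz0).symm

theorem eval_eq_eval_zero_mul_prod_roots {K : Type*} [Field K] {R : K[X]} (hR : R.Splits)
    (h0 : R.eval 0 ≠ 0) (t : K) : R.eval t = R.eval 0 * (R.roots.map fun r => 1 - t / r).prod := by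
  rw [hR.eval_eq_prod_roots t, hR.eval_eq_prod_roots 0, mul_assoc, ← Multiset.prod_map_mul]
  congr 2
  refine Multiset.map_congr rfl fun r hr => ?_
  have hr0 : r ≠ 0 := by
    rintro rfl
    exact h0 (mem_roots'.1 hr).2
  field_simp
  ring

theorem neg_of_mem_roots_of_coeff_nonneg {R : ℝ[X]} (hnn : ∀ k, 0 ≤ R.coeff k)
    (h0 : 0 < R.coeff 0) {r : ℝ} (hr : r ∈ R.roots) : r < 0 := by
  by_contra! hr0
  have hle : R.coeff 0 * r ^ 0 ≤ R.eval r := by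
    rw [eval_eq_sum_range]
    exact Finset.single_le_sum (f := fun k => R.coeff k * r ^ k)
      (fun k _ => mul_nonneg (hnn k) (pow_nonneg hr0 k)) (by simp)
  rw [(mem_roots'.1 hr).2, pow_zero, mul_one] at hle
  exact hle.not_gt h0

theorem eval_le_mul_pow_of_splits {R : ℝ[X]} (hR : R.Splits) (hnn : ∀ k, 0 ≤ R.coeff k)
    (h0 : 0 < R.coeff 0) {N : ℕ} (hN : N ≠ 0) (hdeg : R.natDegree ≤ N) {t : ℝ} (ht : 0 ≤ t) :
    R.eval t ≤ R.coeff 0 * (1 + t * (R.coeff 1 / R.coeff 0) / N) ^ N := by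
  have hR0 : R.eval 0 = R.coeff 0 := (coeff_zero_eq_eval_zero R).symm
  have hR0' : R.eval 0 ≠ 0 := hR0 ▸ h0.ne'
  let A : Multiset ℝ := R.roots.map fun r => -(t / r)
  have hA : ∀ a ∈ A, 0 ≤ a := by
    intro a ha
    obtain ⟨r, hr, rfl⟩ := Multiset.mem_map.1 ha
    exact neg_nonneg.2
      (div_nonpos_of_nonneg_of_nonpos ht (neg_of_mem_roots_of_coeff_nonneg hnn h0 hr).le)
  have hA_card : A.card ≤ N := by simpa [A] using (card_roots' R).trans hdeg
  have hA_sum : A.sum = t * (R.coeff 1 / R.coeff 0) := by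
    have hlog := hR.eval_derivative_div_eval_of_ne_zero hR0'
    rw [hR0, ← coeff_zero_eq_eval_zero, coeff_derivative] at hlog
    simp only [zero_add, Nat.cast_zero, mul_one] at hlog
    rw [hlog, ← Multiset.sum_map_mul_left]
    simp [A, div_eq_mul_inv, inv_neg]
  calc R.eval t = R.coeff 0 * (A.map fun a => 1 + a).prod := by
        rw [eval_eq_eval_zero_mul_prod_roots hR hR0', hR0]
        simp [A, sub_eq_add_neg]
    _ ≤ R.coeff 0 * (1 + t * (R.coeff 1 / R.coeff 0) / N) ^ N := by
        rw [← hA_sum]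
        gcongr
        exact multiset_prod_one_add_le hA hN hA_card

theorem le_norm_coeff_one_of_forall_mul_le_norm_eval {𝕜 : Type*} [NormedField 𝕜]
    [NormedAlgebra ℝ 𝕜] {R : 𝕜[X]} (h0 : R.coeff 0 = 0) {w : 𝕜} (hw : ‖w‖ = 1) {c : ℝ}
    (h : ∀ t : ℝ, 0 < t → c * t ≤ ‖R.eval (t • w)‖) : c ≤ ‖R.coeff 1‖ := by
  have hle : ∀ t : ℝ, 0 < t → c ≤ ‖R.divX.eval (t • w)‖ := by
    intro t ht
    refine le_of_mul_le_mul_right ((h t ht).trans_eq ?_) ht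
    conv_lhs => rw [← divX_mul_X_add R, h0]
    simp [norm_smul, hw, abs_of_pos ht, mul_comm]
  have hcont : Continuous fun t : ℝ => ‖R.divX.eval (t • w)‖ := by fun_prop
  have hlim := (hcont.tendsto 0).mono_left (nhdsWithin_le_nhds (s := Set.Ioi 0))
  have hc := ge_of_tendsto hlim (by filter_upwards [self_mem_nhdsWithin] with t ht using hle t ht)
  simpa [← coeff_zero_eq_eval_zero, coeff_divX] using hc

theorem mul_gurvitsConst_le_coeff_one {R : ℝ[X]} (hR : R.Splits) (hnn : ∀ k, 0 ≤ R.coeff k)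
    {d : ℕ} (hdeg : R.natDegree ≤ d + 1) {C : ℝ} (hC : 0 ≤ C)
    (h : ∀ t : ℝ, 0 < t → C * t ≤ R.eval t) : C * gurvitsConst d ≤ R.coeff 1 := by
  rcases (hnn 0).eq_or_lt with h0 | h0
  · have hC1 := le_norm_coeff_one_of_forall_mul_le_norm_eval h0.symm (norm_one (α := ℝ))
      fun t ht => (h t ht).trans (by simpa using le_abs_self _)
    rw [Real.norm_of_nonneg (hnn 1)] at hC1
    exact (mul_le_of_le_one_right hC (gurvitsConst_le_one d)).trans hC1
  · rw [← mul_div_cancel₀ (R.coeff 1) h0.ne']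
    exact mul_gurvitsConst_le_of_forall_mul_le h0 (div_nonneg (hnn 1) h0.le) fun t ht =>
      (h t ht).trans (eval_le_mul_pow_of_splits hR hnn h0 d.succ_ne_zero hdeg ht.le)

theorem norm_eval_zero_le_norm_eval_of_re_eq_zero {R : ℂ[X]} (hR : ∀ r, R.IsRoot r → r.im = 0)
    {w : ℂ} (hw : w.re = 0) : ‖R.eval 0‖ ≤ ‖R.eval w‖ := by
  have hfactor : ∀ z, ‖R.eval z‖ = ‖R.leadingCoeff‖ * (R.roots.map fun r => ‖z - r‖).prod := by
    intro z
    rw [(IsAlgClosed.splits R).eval_eq_prod_roots, norm_mul]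
    congr 1
    simpa using map_multiset_prod (normHom : ℂ →*₀ ℝ) (R.roots.map fun r => z - r)
  rw [hfactor, hfactor]
  refine mul_le_mul_of_nonneg_left (Multiset.prod_map_le_prod_map₀ _ _ (fun _ _ => norm_nonneg _)
    fun r hr => ?_) (norm_nonneg _)
  calc ‖0 - r‖ = |(w - r).re| := by
        rw [← Complex.abs_re_eq_norm.2] <;> simp [hw, hR r (mem_roots'.1 hr).2]
    _ ≤ ‖w - r‖ := Complex.abs_re_le_norm _

theorem coeff_one_ne_zero_of_forall_isRoot_im_neg {R : ℂ[X]} (hdeg : 0 < R.degree)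
    (hR : ∀ r, R.IsRoot r → r.im < 0) : R.coeff 1 ≠ 0 := by
  intro h1
  have hmem : (0 : ℂ) ∈ R.derivative.rootSet ℂ :=
    mem_rootSet.2 ⟨derivative_ne_zero.2 (natDegree_pos_iff_degree_pos.2 hdeg).ne',
      by simp [← coeff_zero_eq_aeval_zero, coeff_derivative, h1]⟩
  have hsub : convexHull ℝ (R.rootSet ℂ) ⊆ {z | z.im < 0} :=
    convexHull_min (fun r hr => hR r (by simpa using (mem_rootSet.1 hr).2))
      (convex_halfSpace_im_lt 0)
  simpa using hsub (rootSet_derivative_subset_convexHull_rootSet hdeg hmem)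

end Univariate

section Multivariate

open MvPolynomial

theorem aeval_mul_of_isHomogeneous {σ R A : Type*} [CommSemiring R] [CommSemiring A] [Algebra R A]
    {p : MvPolynomial σ R} {d : ℕ} (hp : p.IsHomogeneous d) (w : A) (z : σ → A) :
    aeval (fun i => w * z i) p = w ^ d * aeval z p := by
  rw [aeval_def, aeval_def, eval₂_eq, eval₂_eq, Finset.mul_sum]
  refine Finset.sum_congr rfl fun α hα => ?_
  simp only [mul_pow]
  rw [Finset.prod_mul_distrib, Finset.prod_pow_eq_pow_sum, ← hp.degree_eq_sum_deg_support hα,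
    mul_left_comm]

theorem aeval_ofReal {σ : Type*} (p : MvPolynomial σ ℝ) (x : σ → ℝ) :
    aeval (fun i => (x i : ℂ)) p = ((eval x p : ℝ) : ℂ) := by
  simpa [Function.comp_def, aeval_eq_eval] using aeval_algebraMap_apply (A := ℝ) ℂ x p

variable {m d : ℕ} {p g h : MvPolynomial (Fin m) ℝ}

theorem NonnegCoeffs.mul (hg : NonnegCoeffs g) (hh : NonnegCoeffs h) : NonnegCoeffs (g * h) := by
  classical
  intro α
  rw [coeff_mul]
  exact Finset.sum_nonneg fun a _ => mul_nonneg (hg _) (hh _)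

theorem NonnegCoeffs.eval_nonneg (hp : NonnegCoeffs p) {x : Fin m → ℝ} (hx : ∀ i, 0 ≤ x i) :
    0 ≤ eval x p := by
  rw [eval_eq']
  exact Finset.sum_nonneg fun α _ =>
    mul_nonneg (hp α) (Finset.prod_nonneg fun i _ => pow_nonneg (hx i) _)

theorem NonnegCoeffs.eval_pos (hp : NonnegCoeffs p) (hp0 : p ≠ 0) {x : Fin m → ℝ}
    (hx : ∀ i, 0 < x i) : 0 < eval x p := by
  rw [eval_eq']
  exact Finset.sum_pos (fun α hα => mul_pos ((hp α).lt_of_ne' (mem_support_iff.1 hα))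
    (Finset.prod_pos fun i _ => pow_pos (hx i) _)) (support_nonempty.2 hp0)

theorem IsRealStable.mul (hg : IsRealStable g) (hh : IsRealStable h) : IsRealStable (g * h) := by
  intro z hz
  rw [map_mul]
  exact mul_ne_zero (hg z hz) (hh z hz)

theorem IsRealStable.aeval_ne_zero_of_mul (hs : IsRealStable p) (hp : p.IsHomogeneous d)
    {z : Fin m → ℂ} (w : ℂ) (hw : ∀ i, 0 < (w * z i).im) : aeval z p ≠ 0 := by
  intro h
  refine hs (fun i => w * z i) hw ?_
  rw [aeval_mul_of_isHomogeneous hp, h, mul_zero]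

theorem IsRealStable.im_eq_zero_of_aeval_mul_add_eq_zero (hs : IsRealStable p)
    (hp : p.IsHomogeneous d) {x y : Fin m → ℝ} (hy : ∀ i, 0 < y i) {s : ℂ}
    (h : aeval (fun i => (x i * s + y i : ℂ)) p = 0) : s.im = 0 := by
  by_contra hne
  refine hs.aeval_ne_zero_of_mul hp (-(s.im : ℂ) * starRingEnd ℂ s) (fun i => ?_) h
  have him : (-(s.im : ℂ) * starRingEnd ℂ s * (x i * s + y i)).im = s.im ^ 2 * y i := by
    simp
    ring
  rw [him]
  exact mul_pos (sq_pos_of_ne_zero hne) (hy i)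

theorem IsRealStable.eval_im_le_norm (hs : IsRealStable p) (hp : p.IsHomogeneous d)
    (hnn : NonnegCoeffs p) {z : Fin m → ℂ} (hz : ∀ i, 0 < (z i).im) :
    eval (fun i => (z i).im) p ≤ ‖aeval z p‖ := by
  let R : Polynomial ℂ :=
    aeval (fun i => Polynomial.C ((z i).re : ℂ) * Polynomial.X + Polynomial.C ((z i).im : ℂ)) p
  have hR : ∀ s : ℂ, R.eval s = aeval (fun i => (z i).re * s + (z i).im) p := by
    intro s
    have hcomp := comp_aeval_apply (R := ℝ)
      (fun i => Polynomial.C ((z i).re : ℂ) * Polynomial.X + Polynomial.C ((z i).im : ℂ))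
      ((Polynomial.aeval (R := ℂ) s).restrictScalars ℝ) p
    simpa [Polynomial.coe_aeval_eq_eval] using hcomp
  have hroots : ∀ r, R.IsRoot r → r.im = 0 := fun r hr =>
    hs.im_eq_zero_of_aeval_mul_add_eq_zero hp hz ((hR r).symm.trans hr)
  have hzero : R.eval 0 = (eval (fun i => (z i).im) p : ℝ) := by
    rw [hR, ← aeval_ofReal]
    simp
  have hnegI : aeval z p = Complex.I ^ d * R.eval (-Complex.I) := by
    rw [hR, ← aeval_mul_of_isHomogeneous hp]
    congr 2
    funext i
    apply Complex.ext <;> simp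
  calc eval (fun i => (z i).im) p = ‖R.eval 0‖ := by
        rw [hzero, Complex.norm_real, Real.norm_of_nonneg (hnn.eval_nonneg fun i => (hz i).le)]
    _ ≤ ‖R.eval (-Complex.I)‖ := norm_eval_zero_le_norm_eval_of_re_eq_zero hroots (by simp)
    _ = ‖aeval z p‖ := by rw [hnegI, norm_mul, norm_pow, Complex.norm_I, one_pow, one_mul]

theorem exists_pos_forall_add_mul_pos {ι : Type*} [Finite ι] {y : ι → ℝ} (hy : ∀ i, 0 < y i)
    (x : ι → ℝ) : ∃ δ : ℝ, 0 < δ ∧ ∀ i, 0 < y i + δ * x i := by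
  have hev : ∀ᶠ δ : ℝ in nhdsWithin 0 (Set.Ioi 0), ∀ i, 0 < y i + δ * x i := by
    refine Filter.eventually_all.2 fun i => nhdsWithin_le_nhds ?_
    have hcont : ContinuousAt (fun δ : ℝ => y i + δ * x i) 0 := by fun_prop
    exact hcont.eventually (lt_mem_nhds (by simpa using hy i))
  obtain ⟨δ, hpos, hδ⟩ := (hev.and self_mem_nhdsWithin).exists
  exact ⟨δ, hδ, hpos⟩

end Multivariate

section Slice

open MvPolynomial

/-- The univariate polynomial `t ↦ p (t, z)` obtained by fixing all variables but the first. -/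
noncomputable def sliceAt {R S : Type*} [CommSemiring R] [CommSemiring S] [Algebra R S] {m : ℕ}
    (p : MvPolynomial (Fin (m + 1)) R) (z : Fin m → S) : Polynomial S :=
  Polynomial.mapAlgHom (aeval z) (finSuccEquiv R m p)

theorem coeff_sliceAt {R S : Type*} [CommSemiring R] [CommSemiring S] [Algebra R S] {m : ℕ}
    (p : MvPolynomial (Fin (m + 1)) R) (z : Fin m → S) (k : ℕ) :
    (sliceAt p z).coeff k = aeval z ((finSuccEquiv R m p).coeff k) :=
  Polynomial.coeff_map _ _

theorem aeval_sliceAt {R S T : Type*} [CommSemiring R] [CommSemiring S] [CommSemiring T]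
    [Algebra R S] [Algebra R T] [Algebra S T] [IsScalarTower R S T] {m : ℕ}
    (p : MvPolynomial (Fin (m + 1)) R) (z : Fin m → S) (t : T) :
    Polynomial.aeval t (sliceAt p z) =
      aeval (Fin.cons t fun i => algebraMap S T (z i) : Fin (m + 1) → T) p := by
  have hcomp : (((Polynomial.aeval (R := S) t).restrictScalars R).comp
      (Polynomial.mapAlgHom (aeval z))).comp (finSuccEquiv R m).toAlgHom =
      aeval (Fin.cons t fun i => algebraMap S T (z i)) := by
    refine algHom_ext fun i => ?_
    refine Fin.cases ?_ (fun j => ?_) i <;> simp [finSuccEquiv_X_zero, finSuccEquiv_X_succ]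
  exact DFunLike.congr_fun hcomp p

theorem eval_sliceAt {R S : Type*} [CommSemiring R] [CommSemiring S] [Algebra R S] {m : ℕ}
    (p : MvPolynomial (Fin (m + 1)) R) (z : Fin m → S) (t : S) :
    (sliceAt p z).eval t = aeval (Fin.cons t z : Fin (m + 1) → S) p := by
  simpa [Polynomial.coe_aeval_eq_eval] using aeval_sliceAt p z t

theorem natDegree_sliceAt_le {R S : Type*} [CommSemiring R] [CommSemiring S] [Algebra R S] {m : ℕ}
    (p : MvPolynomial (Fin (m + 1)) R) (z : Fin m → S) :
    (sliceAt p z).natDegree ≤ p.degreeOf 0 :=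
  Polynomial.natDegree_map_le.trans_eq (natDegree_finSuccEquiv p)

theorem mul_coeff_one_le_eval {R : Polynomial ℝ} (hR : ∀ k, 0 ≤ R.coeff k) {t : ℝ} (ht : 0 ≤ t) :
    t * R.coeff 1 ≤ R.eval t := by
  rw [Polynomial.eval_eq_sum_range' (Nat.lt_add_of_pos_right two_pos)]
  simpa [mul_comm] using Finset.single_le_sum (f := fun k => R.coeff k * t ^ k)
    (fun k _ => mul_nonneg (hR k) (pow_nonneg ht k))
    (Finset.mem_range.2 (by lia : 1 < R.natDegree + 2))

variable {m d : ℕ} {p : MvPolynomial (Fin (m + 1)) ℝ}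

theorem NonnegCoeffs.coeff_finSuccEquiv (hp : NonnegCoeffs p) (k : ℕ) :
    NonnegCoeffs ((finSuccEquiv ℝ m p).coeff k) := fun α => by
  rw [finSuccEquiv_coeff_coeff]
  exact hp _

theorem NonnegCoeffs.coeff_sliceAt_nonneg (hp : NonnegCoeffs p) {x : Fin m → ℝ}
    (hx : ∀ i, 0 ≤ x i) (k : ℕ) : 0 ≤ (sliceAt p x).coeff k := by
  rw [coeff_sliceAt, aeval_eq_eval]
  exact (hp.coeff_finSuccEquiv k).eval_nonneg hx

theorem IsRealStable.im_neg_of_isRoot_sliceAt (hs : IsRealStable p) (hp : p.IsHomogeneous d)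
    {z : Fin m → ℂ} (hz : ∀ i, 0 < (z i).im) {r : ℂ} (hr : (sliceAt p z).IsRoot r) (hr0 : r ≠ 0) :
    r.im < 0 := by
  rw [Polynomial.IsRoot, eval_sliceAt] at hr
  by_contra! hle
  rcases hle.lt_or_eq with him | him
  · exact hs _ (Fin.cases (by simpa using him) (by simpa using hz)) hr
  · -- A nonzero real root is rotated into the upper half-plane together with `z`.
    obtain ⟨δ, hδ, hδz⟩ := exists_pos_forall_add_mul_pos hz fun i => r.re * (z i).re
    have hre : r.re ≠ 0 := fun h => hr0 (Complex.ext h him.symm)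
    refine hs.aeval_ne_zero_of_mul hp (1 + (δ * r.re : ℝ) * Complex.I)
      (Fin.cases ?_ fun j => ?_) hr
    · have : 0 < δ * r.re * r.re := by
        rw [mul_assoc]
        exact mul_pos hδ (mul_self_pos.2 hre)
      simpa [← him] using this
    · simpa [mul_assoc] using hδz j

theorem IsRealStable.mul_eval_im_coeff_one_le_norm_eval_sliceAt (hs : IsRealStable p)
    (hp : p.IsHomogeneous d) (hnn : NonnegCoeffs p) {z : Fin m → ℂ} (hz : ∀ i, 0 < (z i).im)
    {t : ℝ} (ht : 0 < t) :
    eval (fun i => (z i).im) ((finSuccEquiv ℝ m p).coeff 1) * t ≤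
      ‖(sliceAt p z).eval (t • Complex.I)‖ := by
  let ζ : Fin (m + 1) → ℂ := Fin.cons (t • Complex.I) z
  have hζ : ∀ i, 0 < (ζ i).im := Fin.cases (by simpa [ζ] using ht) (by simpa [ζ] using hz)
  have hζ_im : (fun i => (ζ i).im) = Fin.cons t fun i => (z i).im := by
    funext i
    refine Fin.cases ?_ (fun j => ?_) i <;> simp [ζ]
  calc eval (fun i => (z i).im) ((finSuccEquiv ℝ m p).coeff 1) * t
      = t * (sliceAt p fun i => (z i).im).coeff 1 := by
        rw [coeff_sliceAt, aeval_eq_eval, mul_comm]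
    _ ≤ (sliceAt p fun i => (z i).im).eval t :=
        mul_coeff_one_le_eval (hnn.coeff_sliceAt_nonneg fun i => (hz i).le) ht.le
    _ = eval (fun i => (ζ i).im) p := by rw [eval_sliceAt, aeval_eq_eval, hζ_im]
    _ ≤ ‖aeval ζ p‖ := hs.eval_im_le_norm hp hnn hζ
    _ = ‖(sliceAt p z).eval (t • Complex.I)‖ := by rw [eval_sliceAt]

theorem IsRealStable.coeff_one_finSuccEquiv (hs : IsRealStable p) (hp : p.IsHomogeneous d)
    (hnn : NonnegCoeffs p) (hq : (finSuccEquiv ℝ m p).coeff 1 ≠ 0) :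
    IsRealStable ((finSuccEquiv ℝ m p).coeff 1) := by
  intro z hz
  have hqpos := (hnn.coeff_finSuccEquiv 1).eval_pos hq hz
  have hgrowth := fun t : ℝ => hs.mul_eval_im_coeff_one_le_norm_eval_sliceAt hp hnn hz (t := t)
  rw [← coeff_sliceAt]
  by_cases h0 : (sliceAt p z).coeff 0 = 0
  · exact norm_pos_iff.1 (hqpos.trans_le
      (le_norm_coeff_one_of_forall_mul_le_norm_eval h0 Complex.norm_I hgrowth))
  · refine coeff_one_ne_zero_of_forall_isRoot_im_neg ?_ fun r hr =>
      hs.im_neg_of_isRoot_sliceAt hp hz hr ?_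
    · by_contra! hdeg
      obtain ⟨a, ha⟩ : ∃ a, sliceAt p z = Polynomial.C a :=
        ⟨_, Polynomial.eq_C_of_degree_le_zero hdeg⟩
      refine (nonpos_of_forall_pos_mul_le (a := ‖a‖) fun t ht => ?_).not_gt hqpos
      simpa only [ha, Polynomial.eval_C] using hgrowth t ht
    · rintro rfl
      exact h0 ((Polynomial.coeff_zero_eq_eval_zero _).trans hr)

theorem IsRealStable.splits_sliceAt (hs : IsRealStable p) (hp : p.IsHomogeneous d)
    {x : Fin m → ℝ} (hx : ∀ i, 0 < x i) : (sliceAt p x).Splits := by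
  refine splits_of_forall_aeval_eq_zero_im_eq_zero fun t ht => ?_
  rw [aeval_sliceAt] at ht
  by_contra hne
  refine hs.aeval_ne_zero_of_mul hp (((1 - t.re) / t.im : ℝ) + Complex.I)
    (Fin.cases ?_ fun j => ?_) ht
  · have him : (1 - t.re) / t.im * t.im + t.re = 1 := by
      rw [div_mul_cancel₀ _ hne, sub_add_cancel]
    simp [him]
  · simpa using hx j

end Slice

section SetCoeff

/-- The exponent vector of the square-free monomial `∏ i ∈ S, z i`. -/
noncomputable def setExponent {ι : Type*} (S : Finset ι) : ι →₀ ℕ := ∑ i ∈ S, Finsupp.single i 1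

theorem setExponent_apply {ι : Type*} [DecidableEq ι] (S : Finset ι) (i : ι) :
    setExponent S i = if i ∈ S then 1 else 0 := by
  simp [setExponent, Finsupp.finsetSum_apply, Finsupp.single_apply]

theorem support_setExponent {ι : Type*} (S : Finset ι) : (setExponent S).support = S := by
  classical
  ext i
  simp [setExponent_apply]

theorem setExponent_injective {ι : Type*} :
    Function.Injective (setExponent : Finset ι → ι →₀ ℕ) :=
  Function.LeftInverse.injective support_setExponent

theorem setExponent_support_of_le {ι : Type*} {a : ι →₀ ℕ} {T : Finset ι}
    (ha : a ≤ setExponent T) : setExponent a.support = a := by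
  classical
  ext i
  have hi : a i ≤ 1 := (ha i).trans (by rw [setExponent_apply]; split_ifs <;> simp)
  rw [setExponent_apply]
  split_ifs with hmem <;> rw [Finsupp.mem_support_iff] at hmem <;> lia

theorem setExponent_add_setExponent_sdiff {ι : Type*} [DecidableEq ι] {S T : Finset ι}
    (hST : S ⊆ T) : setExponent S + setExponent (T \ S) = setExponent T :=
  (add_comm _ _).trans (Finset.sum_sdiff hST)

theorem setExponent_univ_succ (m : ℕ) :
    setExponent (Finset.univ : Finset (Fin (m + 1))) =
      Finsupp.cons 1 (setExponent (Finset.univ : Finset (Fin m))) := by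
  ext i
  refine Fin.cases ?_ (fun j => ?_) i <;> simp [setExponent_apply]

open MvPolynomial

variable {m d : ℕ} {p g h : MvPolynomial (Fin m) ℝ}

theorem NonnegCoeffs.setCoeff_nonneg (hp : NonnegCoeffs p) (S : Finset (Fin m)) :
    0 ≤ setCoeff p S := hp _

theorem NonnegCoeffs.familyCoeff_nonneg (hp : NonnegCoeffs p) (B : Finset (Finset (Fin m))) :
    0 ≤ familyCoeff B p := Finset.sum_nonneg fun S _ => hp.setCoeff_nonneg S

theorem card_eq_of_setCoeff_ne_zero (hp : p.IsHomogeneous d) {S : Finset (Fin m)}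
    (hS : setCoeff p S ≠ 0) : S.card = d := by
  have hdeg : (∑ i ∈ S, Finsupp.single i 1 : Fin m →₀ ℕ).degree = d :=
    not_imp_comm.1 hp.coeff_eq_zero hS
  simpa [map_sum] using hdeg

theorem setCoeff_mul (g h : MvPolynomial (Fin m) ℝ) (T : Finset (Fin m)) :
    setCoeff (g * h) T = ∑ S ∈ T.powerset, setCoeff g S * setCoeff h (T \ S) := by
  refine (coeff_mul ..).trans (Finset.sum_nbij (fun S => (setExponent S, setExponent (T \ S)))
    (fun S hS => ?_) (fun S _ S' _ hSS' => setExponent_injective (congrArg Prod.fst hSS')) ?_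
    fun _ _ => rfl).symm
  · exact Finset.HasAntidiagonal.mem_antidiagonal.2
      (setExponent_add_setExponent_sdiff (Finset.mem_powerset.1 hS))
  · rintro ⟨a, b⟩ hab
    have hab' : a + b = setExponent T := Finset.HasAntidiagonal.mem_antidiagonal.1 hab
    have hle : a ≤ setExponent T := hab' ▸ le_self_add
    have hsub : a.support ⊆ T := support_setExponent T ▸ Finsupp.support_mono hle
    have hsum := setExponent_add_setExponent_sdiff hsub
    rw [setExponent_support_of_le hle, ← hab', add_right_inj] at hsum
    exact ⟨a.support, by simpa using hsub, Prod.ext (setExponent_support_of_le hle) hsum⟩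

theorem NonnegCoeffs.sum_setCoeff_mul_le_eval (hp : NonnegCoeffs p)
    (B : Finset (Finset (Fin m))) {z : Fin m → ℝ} (hz : ∀ i, 0 ≤ z i) :
    ∑ S ∈ B, setCoeff p S * ∏ i ∈ S, z i ≤ eval z p := by
  classical
  calc ∑ S ∈ B, setCoeff p S * ∏ i ∈ S, z i
      = ∑ α ∈ B.image setExponent, p.coeff α * ∏ i, z i ^ α i := by
        rw [Finset.sum_image setExponent_injective.injOn]
        refine Finset.sum_congr rfl fun S _ => ?_
        simp only [setExponent_apply, pow_ite, pow_one, pow_zero, Finset.prod_ite_mem,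
          Finset.univ_inter]
        rfl
    _ ≤ ∑ α ∈ p.support ∪ B.image setExponent, p.coeff α * ∏ i, z i ^ α i :=
        Finset.sum_le_sum_of_subset_of_nonneg Finset.subset_union_right fun α _ _ =>
          mul_nonneg (hp α) (Finset.prod_nonneg fun i _ => pow_nonneg (hz i) _)
    _ = eval z p := by
        rw [eval_eq']
        refine (Finset.sum_subset Finset.subset_union_left fun α _ hα => ?_).symm
        rw [notMem_support_iff.1 hα, zero_mul]

end SetCoeff

section Capacity

open MvPolynomial

variable {m : ℕ} {p g h : MvPolynomial (Fin m) ℝ} {B : Finset (Finset (Fin m))}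

theorem prod_rpow_pos {z : Fin m → ℝ} (hz : ∀ i, 0 < z i) (θ : Fin m → ℝ) :
    0 < ∏ i, z i ^ θ i := Finset.prod_pos fun i _ => Real.rpow_pos_of_pos (hz i) _

theorem NonnegCoeffs.div_prod_rpow_nonneg (hp : NonnegCoeffs p) (θ : Fin m → ℝ)
    (z : {z : Fin m → ℝ // ∀ i, 0 < z i}) : 0 ≤ eval z.1 p / ∏ i, z.1 i ^ θ i :=
  div_nonneg (hp.eval_nonneg fun i => (z.2 i).le) (prod_rpow_pos z.2 θ).le

theorem NonnegCoeffs.capAt_nonneg (hp : NonnegCoeffs p) (θ : Fin m → ℝ) : 0 ≤ capAt p θ :=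
  Real.iInf_nonneg (hp.div_prod_rpow_nonneg θ)

theorem NonnegCoeffs.capAt_mul_prod_rpow_le (hp : NonnegCoeffs p) (θ : Fin m → ℝ)
    {z : Fin m → ℝ} (hz : ∀ i, 0 < z i) : capAt p θ * ∏ i, z i ^ θ i ≤ eval z p :=
  (le_div_iff₀ (prod_rpow_pos hz θ)).1
    (ciInf_le ⟨0, Set.forall_mem_range.2 (hp.div_prod_rpow_nonneg θ)⟩ ⟨z, hz⟩)

theorem le_capAt {a : ℝ} {θ : Fin m → ℝ}
    (h : ∀ z : Fin m → ℝ, (∀ i, 0 < z i) → a * ∏ i, z i ^ θ i ≤ eval z p) : a ≤ capAt p θ :=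
  have : Nonempty {z : Fin m → ℝ // ∀ i, 0 < z i} := ⟨⟨1, fun _ => one_pos⟩⟩
  le_ciInf fun z => (le_div_iff₀ (prod_rpow_pos z.2 θ)).2 (h z.1 z.2)

theorem NonnegCoeffs.capAt_mul_capAt_le (hg : NonnegCoeffs g) (hh : NonnegCoeffs h)
    (θ η : Fin m → ℝ) : capAt g θ * capAt h η ≤ capAt (g * h) (θ + η) := by
  refine le_capAt fun z hz => ?_
  have hprod : ∏ i, z i ^ (θ + η) i = (∏ i, z i ^ θ i) * ∏ i, z i ^ η i := by
    simp only [Pi.add_apply, Real.rpow_add (hz _), Finset.prod_mul_distrib]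
  rw [hprod, map_mul, mul_mul_mul_comm]
  exact mul_le_mul (hg.capAt_mul_prod_rpow_le θ hz) (hh.capAt_mul_prod_rpow_le η hz)
    (mul_nonneg (hh.capAt_nonneg η) (prod_rpow_pos hz η).le) (hg.eval_nonneg fun i => (hz i).le)

theorem NonnegCoeffs.capAt_le_cap (hp : NonnegCoeffs p) {θ : Fin m → ℝ} (hθ : θ ∈ polytope B) :
    capAt p θ ≤ cap B p :=
  le_ciSup (f := fun θ : polytope B => capAt p θ.1) ⟨eval 1 p, Set.forall_mem_range.2 fun θ => by
    simpa using hp.capAt_mul_prod_rpow_le θ.1 (z := 1) fun _ => one_pos⟩ ⟨θ, hθ⟩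

theorem NonnegCoeffs.lowerCap_le_capAt (hp : NonnegCoeffs p) {θ : Fin m → ℝ}
    (hθ : θ ∈ polytope B) : lowerCap B p ≤ capAt p θ :=
  ciInf_le (f := fun θ : polytope B => capAt p θ.1)
    ⟨0, Set.forall_mem_range.2 fun θ => hp.capAt_nonneg θ.1⟩ ⟨θ, hθ⟩

theorem NonnegCoeffs.lowerCap_nonneg (hp : NonnegCoeffs p) (B : Finset (Finset (Fin m))) :
    0 ≤ lowerCap B p := Real.iInf_nonneg fun θ => hp.capAt_nonneg θ.1

theorem prod_rpow_sum_smul_indicator {z : Fin m → ℝ} (hz : ∀ i, 0 < z i)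
    (B : Finset (Finset (Fin m))) (w : Finset (Fin m) → ℝ) :
    ∏ i, z i ^ (∑ S ∈ B, w S • fun i => if i ∈ S then (1 : ℝ) else 0) i =
      ∏ S ∈ B, (∏ i ∈ S, z i) ^ w S := by
  have hfactor : ∀ S, ∏ i, z i ^ (if i ∈ S then w S else 0) = (∏ i ∈ S, z i) ^ w S := by
    intro S
    rw [← Real.finsetProd_rpow _ _ fun i _ => (hz i).le]
    simp [Finset.prod_ite_mem, apply_ite]
  simp only [Finset.sum_apply, Pi.smul_apply, smul_eq_mul, mul_ite, mul_one, mul_zero,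
    Real.rpow_sum_of_pos (hz _)]
  rw [Finset.prod_comm]
  exact Finset.prod_congr rfl fun S _ => hfactor S

theorem NonnegCoeffs.familyCoeff_le_capAt (hp : NonnegCoeffs p) {w : Finset (Fin m) → ℝ}
    (hw : ∀ S ∈ B, 0 ≤ w S) (hw_sum : ∑ S ∈ B, w S = 1)
    (hw_mul : ∀ S ∈ B, familyCoeff B p * w S = setCoeff p S) :
    familyCoeff B p ≤ capAt p (∑ S ∈ B, w S • fun i => if i ∈ S then (1 : ℝ) else 0) := by
  refine le_capAt fun z hz => ?_
  have hamgm := Real.geom_mean_le_arith_mean_weighted B w (fun S => ∏ i ∈ S, z i) hw hw_sum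
    fun S _ => Finset.prod_nonneg fun i _ => (hz i).le
  calc familyCoeff B p * ∏ i, z i ^ (∑ S ∈ B, w S • fun i => if i ∈ S then (1 : ℝ) else 0) i
      = familyCoeff B p * ∏ S ∈ B, (∏ i ∈ S, z i) ^ w S := by
        rw [prod_rpow_sum_smul_indicator hz]
    _ ≤ familyCoeff B p * ∑ S ∈ B, w S * ∏ i ∈ S, z i :=
        mul_le_mul_of_nonneg_left hamgm (hp.familyCoeff_nonneg B)
    _ = ∑ S ∈ B, setCoeff p S * ∏ i ∈ S, z i := by
        rw [Finset.mul_sum]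
        exact Finset.sum_congr rfl fun S hS => by rw [← mul_assoc, hw_mul S hS]
    _ ≤ eval z p := hp.sum_setCoeff_mul_le_eval B fun i => (hz i).le

theorem NonnegCoeffs.familyCoeff_le_cap (hp : NonnegCoeffs p) (B : Finset (Finset (Fin m))) :
    familyCoeff B p ≤ cap B p := by
  rcases (hp.familyCoeff_nonneg B).eq_or_lt with hzero | hpos
  · rw [← hzero]
    exact Real.iSup_nonneg fun θ => hp.capAt_nonneg θ.1
  let w : Finset (Fin m) → ℝ := fun S => setCoeff p S / familyCoeff B p
  have hw : ∀ S ∈ B, 0 ≤ w S := fun S _ => div_nonneg (hp.setCoeff_nonneg S) hpos.le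
  have hw_sum : ∑ S ∈ B, w S = 1 := (Finset.sum_div ..).symm.trans (div_self hpos.ne')
  have hmem : ∑ S ∈ B, w S • (fun i => if i ∈ S then (1 : ℝ) else 0) ∈ polytope B :=
    (convex_convexHull ℝ _).sum_mem hw hw_sum fun S hS => subset_convexHull ℝ _ ⟨S, hS, rfl⟩
  exact (hp.familyCoeff_le_capAt hw hw_sum fun S _ => mul_div_cancel₀ _ hpos.ne').trans
    (hp.capAt_le_cap hmem)

theorem one_sub_mem_polytope_dualFamily {θ : Fin m → ℝ} (hθ : θ ∈ polytope B) :
    1 - θ ∈ polytope (dualFamily B) := by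
  let reflect : (Fin m → ℝ) →ᵃ[ℝ] (Fin m → ℝ) := AffineMap.const ℝ _ 1 - AffineMap.id ℝ _
  have hsub : polytope B ⊆ reflect ⁻¹' polytope (dualFamily B) := by
    refine convexHull_min ?_ ((convex_convexHull ℝ _).affine_preimage reflect)
    rintro _ ⟨S, hS, rfl⟩
    refine subset_convexHull ℝ _ ⟨Sᶜ, Finset.mem_coe.2 (Finset.mem_image_of_mem _ hS), ?_⟩
    funext i
    by_cases hi : i ∈ S <;> simp [reflect, hi]
  simpa [reflect] using hsub hθ

end Capacity

section Gurvits

open MvPolynomial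

theorem IsRealStable.capAt_one_mul_gurvitsConst_le {m d : ℕ} {p : MvPolynomial (Fin (m + 1)) ℝ}
    (hs : IsRealStable p) (hp : p.IsHomogeneous d) (hnn : NonnegCoeffs p) {k : ℕ}
    (hk : p.degreeOf 0 ≤ k + 1) :
    capAt p 1 * gurvitsConst k ≤ capAt ((finSuccEquiv ℝ m p).coeff 1) 1 := by
  refine le_capAt fun x hx => ?_
  have hcoeff := mul_gurvitsConst_le_coeff_one (hs.splits_sliceAt hp hx)
    (hnn.coeff_sliceAt_nonneg fun i => (hx i).le) ((natDegree_sliceAt_le p x).trans hk)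
    (mul_nonneg (hnn.capAt_nonneg 1) (prod_rpow_pos hx 1).le) fun t ht => by
      have hcap := hnn.capAt_mul_prod_rpow_le 1 (z := Fin.cons t x)
        (Fin.cases (by simpa using ht) (by simpa using hx))
      simpa [eval_sliceAt, aeval_eq_eval, Fin.prod_univ_succ, mul_assoc, mul_comm t] using hcap
  rwa [mul_right_comm, coeff_sliceAt, aeval_eq_eval] at hcoeff

theorem IsRealStable.capAt_one_mul_prod_gurvitsConst_le {m : ℕ} {p : MvPolynomial (Fin m) ℝ}
    (hs : IsRealStable p) (hp : p.IsHomogeneous m) (hnn : NonnegCoeffs p) {K : Fin m → ℕ}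
    (hK : ∀ i, p.degreeOf i ≤ K i + 1) :
    capAt p 1 * ∏ i, gurvitsConst (min i.rev (K i)) ≤ setCoeff p Finset.univ := by
  induction m with
  | zero =>
    have hcap := hnn.capAt_mul_prod_rpow_le 1 (z := 1) fun _ => one_pos
    rw [eq_C_of_isEmpty p, eval_C, ← eq_C_of_isEmpty p] at hcap
    simpa [setCoeff] using hcap
  | succ m ih =>
    let q := (finSuccEquiv ℝ m p).coeff 1
    have hq_coeff : setCoeff q Finset.univ = setCoeff p Finset.univ := by
      change q.coeff (setExponent _) = p.coeff (setExponent _)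
      rw [setExponent_univ_succ, ← finSuccEquiv_coeff_coeff]
    have hq : capAt q 1 * ∏ i : Fin m, gurvitsConst (min i.rev (K i.succ)) ≤
        setCoeff q Finset.univ := by
      by_cases hq0 : q = 0
      · simp [hq0, capAt, setCoeff]
      · exact ih (hs.coeff_one_finSuccEquiv hp hnn hq0)
          (hp.finSuccEquiv_coeff_isHomogeneous 1 m (add_comm 1 m)) (hnn.coeff_finSuccEquiv 1)
          fun i => (degreeOf_coeff_finSuccEquiv p i 1).trans (hK i.succ)
    have hdeg : p.degreeOf 0 ≤ min m (K 0) + 1 := by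
      have := (degreeOf_le_totalDegree p 0).trans hp.totalDegree_le
      have := hK 0
      lia
    calc capAt p 1 * ∏ i, gurvitsConst (min i.rev (K i))
        = capAt p 1 * gurvitsConst (min m (K 0)) *
            ∏ i : Fin m, gurvitsConst (min i.rev (K i.succ)) := by
          simp [Fin.prod_univ_succ, mul_assoc]
      _ ≤ capAt q 1 * ∏ i : Fin m, gurvitsConst (min i.rev (K i.succ)) :=
          mul_le_mul_of_nonneg_right (hs.capAt_one_mul_gurvitsConst_le hp hnn hdeg)
            (Finset.prod_nonneg fun i _ => gurvitsConst_nonneg _)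
      _ ≤ setCoeff p Finset.univ := hq.trans_eq hq_coeff

theorem IsRealStable.capAt_one_mul_factorial_le {m : ℕ} {p : MvPolynomial (Fin m) ℝ}
    (hs : IsRealStable p) (hp : p.IsHomogeneous m) (hnn : NonnegCoeffs p) :
    capAt p 1 * ((m.factorial : ℝ) / (m : ℝ) ^ m) ≤ setCoeff p Finset.univ := by
  have hprod : ∏ i : Fin m, gurvitsConst (min i.rev m) = (m.factorial : ℝ) / (m : ℝ) ^ m := by
    rw [← prod_range_gurvitsConst, ← Fin.prod_univ_eq_prod_range,
      ← Equiv.prod_comp Fin.revPerm (fun i : Fin m => gurvitsConst i)]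
    exact Finset.prod_congr rfl fun i _ => by rw [min_eq_left i.rev.is_lt.le, Fin.revPerm_apply]
  rw [← hprod]
  exact hs.capAt_one_mul_prod_gurvitsConst_le hp hnn (K := fun _ => m) fun i =>
    ((degreeOf_le_totalDegree p i).trans hp.totalDegree_le).trans m.le_succ

theorem IsRealStable.capAt_one_mul_two_pow_le {m : ℕ} {p : MvPolynomial (Fin m) ℝ}
    (hs : IsRealStable p) (hp : p.IsHomogeneous m) (hnn : NonnegCoeffs p)
    (hdeg : ∀ i, p.degreeOf i ≤ 2) :
    capAt p 1 * (1 / (2 : ℝ) ^ m) ≤ setCoeff p Finset.univ := by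
  have hprod : 1 / (2 : ℝ) ^ m ≤ ∏ i : Fin m, gurvitsConst (min i.rev 1) := by
    simpa using Finset.prod_le_prod (s := Finset.univ) (fun (_ : Fin m) _ => one_half_pos.le)
      fun i _ => half_le_gurvitsConst_min_one i.rev
  exact (mul_le_mul_of_nonneg_left hprod (hnn.capAt_nonneg 1)).trans
    (hs.capAt_one_mul_prod_gurvitsConst_le hp hnn (K := fun _ => 1) hdeg)

end Gurvits

section Selection

open MvPolynomial

variable {m n k : ℕ} {c : ℝ} {B F : Finset (Finset (Fin m))} {g h : MvPolynomial (Fin m) ℝ}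

theorem IsSelection.isApproxSelection (hh : IsSelection k F h) : IsApproxSelection 1 k F h where
  nonneg := hh.nonneg
  homogeneous := hh.homogeneous
  mem_of_pos := hh.mem_of_pos
  mem_Icc S hS := by simp [hh.eq_one S hS]

theorem IsApproxSelection.setCoeff_eq_zero (hh : IsApproxSelection c k F h) {S : Finset (Fin m)}
    (hS : S ∉ F) : setCoeff h S = 0 := by
  by_contra hne
  exact hS (hh.mem_of_pos S (card_eq_of_setCoeff_ne_zero hh.homogeneous hne)
    ((hh.nonneg.setCoeff_nonneg S).lt_of_ne' hne))

theorem compl_mem_dualFamily {S : Finset (Fin m)} : Sᶜ ∈ dualFamily B ↔ S ∈ B := by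
  simp [dualFamily]

theorem IsApproxSelection.setCoeff_mul_univ_le (hh : IsApproxSelection c k (dualFamily B) h)
    (hg : NonnegCoeffs g) : setCoeff (g * h) Finset.univ ≤ c * familyCoeff B g := by
  calc setCoeff (g * h) Finset.univ
      = ∑ S : Finset (Fin m), setCoeff g S * setCoeff h Sᶜ := by
        rw [setCoeff_mul, Finset.powerset_univ]
        rfl
    _ = ∑ S ∈ B, setCoeff g S * setCoeff h Sᶜ := by
        refine (Finset.sum_subset (Finset.subset_univ B) fun S _ hS => ?_).symm
        rw [hh.setCoeff_eq_zero (compl_mem_dualFamily.not.2 hS), mul_zero]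
    _ ≤ ∑ S ∈ B, setCoeff g S * c := Finset.sum_le_sum fun S hS =>
        mul_le_mul_of_nonneg_left (hh.mem_Icc _ (compl_mem_dualFamily.2 hS)).2
          (hg.setCoeff_nonneg S)
    _ = c * familyCoeff B g := by rw [← Finset.sum_mul, mul_comm, familyCoeff]

theorem IsApproxSelection.cap_mul_lowerCap_mul_div_le (hh : IsApproxSelection c k (dualFamily B) h)
    (hc : 0 < c) (hg : NonnegCoeffs g) {κ : ℝ} (hκ : 0 ≤ κ)
    (hgh : B.Nonempty → capAt (g * h) 1 * κ ≤ setCoeff (g * h) Finset.univ) :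
    cap B g * lowerCap (dualFamily B) h * κ / c ≤ familyCoeff B g := by
  rw [div_le_iff₀' hc, mul_assoc, cap,
    Real.iSup_mul_of_nonneg (mul_nonneg (hh.nonneg.lowerCap_nonneg _) hκ)]
  refine Real.iSup_le (fun θ => ?_) (mul_nonneg hc.le (hg.familyCoeff_nonneg B))
  have hB : B.Nonempty := by simpa using convexHull_nonempty_iff.1 ⟨θ.1, θ.2⟩
  calc capAt g θ * (lowerCap (dualFamily B) h * κ)
      = capAt g θ * lowerCap (dualFamily B) h * κ := (mul_assoc ..).symm
    _ ≤ capAt g θ * capAt h (1 - θ) * κ := by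
        gcongr
        · exact hg.capAt_nonneg θ
        · exact hh.nonneg.lowerCap_le_capAt (one_sub_mem_polytope_dualFamily θ.2)
    _ ≤ capAt (g * h) 1 * κ := by
        gcongr
        simpa using hg.capAt_mul_capAt_le hh.nonneg θ (1 - θ)
    _ ≤ setCoeff (g * h) Finset.univ := hgh hB
    _ ≤ c * familyCoeff B g := hh.setCoeff_mul_univ_le hg

theorem isHomogeneous_mul_of_card_eq (hB : ∀ S ∈ B, S.card = n) (hne : B.Nonempty)
    (hg : g.IsHomogeneous n) (hh : h.IsHomogeneous (m - n)) : (g * h).IsHomogeneous m := by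
  obtain ⟨S, hS⟩ := hne
  have hnm : n ≤ m := by simpa [hB S hS] using S.card_le_univ
  simpa only [Nat.add_sub_cancel' hnm] using hg.mul hh

theorem IsApproxSelection.cap_mul_lowerCap_mul_factorial_div_le
    (hh : IsApproxSelection c (m - n) (dualFamily B) h) (hhs : IsRealStable h) (hc : 0 < c)
    (hB : ∀ S ∈ B, S.card = n) (hg : NonnegCoeffs g) (hgs : IsRealStable g)
    (hghom : g.IsHomogeneous n) :
    cap B g * lowerCap (dualFamily B) h * ((m.factorial : ℝ) / (m : ℝ) ^ m) / c ≤
      familyCoeff B g :=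
  hh.cap_mul_lowerCap_mul_div_le hc hg (by positivity) fun hne =>
    (hgs.mul hhs).capAt_one_mul_factorial_le
      (isHomogeneous_mul_of_card_eq hB hne hghom hh.homogeneous) (hg.mul hh.nonneg)

theorem IsMultiaffine.degreeOf_mul_le_two (hg : IsMultiaffine g) (hh : IsMultiaffine h)
    (i : Fin m) : (g * h).degreeOf i ≤ 2 :=
  (degreeOf_mul_le i g h).trans (add_le_add (degreeOf_le_iff.2 fun α hα => hg α hα i)
    (degreeOf_le_iff.2 fun α hα => hh α hα i))

theorem IsApproxSelection.cap_mul_lowerCap_mul_two_pow_div_le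
    (hh : IsApproxSelection c (m - n) (dualFamily B) h) (hhs : IsRealStable h)
    (hhm : IsMultiaffine h) (hc : 0 < c) (hB : ∀ S ∈ B, S.card = n) (hg : NonnegCoeffs g)
    (hgs : IsRealStable g) (hghom : g.IsHomogeneous n) (hgm : IsMultiaffine g) :
    cap B g * lowerCap (dualFamily B) h * (1 / (2 : ℝ) ^ m) / c ≤ familyCoeff B g :=
  hh.cap_mul_lowerCap_mul_div_le hc hg (by positivity) fun hne =>
    (hgs.mul hhs).capAt_one_mul_two_pow_le
      (isHomogeneous_mul_of_card_eq hB hne hghom hh.homogeneous) (hg.mul hh.nonneg)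
      (hgm.degreeOf_mul_le_two hhm)

end Selection

end SetCapacity

theorem lemma3p3 (m n : ℕ) (B : Finset (Finset (Fin m))) (hB : ∀ S ∈ B, S.card = n)
    (g : MvPolynomial (Fin m) ℝ) (hg_nonneg : SetCapacity.NonnegCoeffs g)
    (hg_stable : SetCapacity.IsRealStable g) (hg_hom : g.IsHomogeneous n) :
    SetCapacity.familyCoeff B g ≤ SetCapacity.cap B g ∧
    (∀ h : MvPolynomial (Fin m) ℝ,
      SetCapacity.IsSelection (m - n) (SetCapacity.dualFamily B) h →
      SetCapacity.IsRealStable h →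
        SetCapacity.cap B g * SetCapacity.lowerCap (SetCapacity.dualFamily B) h
            * ((m.factorial : ℝ) / (m : ℝ) ^ m) ≤ SetCapacity.familyCoeff B g ∧
        (SetCapacity.IsMultiaffine g → SetCapacity.IsMultiaffine h →
          SetCapacity.cap B g * SetCapacity.lowerCap (SetCapacity.dualFamily B) h
            * (1 / (2 : ℝ) ^ m) ≤ SetCapacity.familyCoeff B g)) ∧
    (∀ c : ℝ, 1 ≤ c → ∀ h : MvPolynomial (Fin m) ℝ,
      SetCapacity.IsApproxSelection c (m - n) (SetCapacity.dualFamily B) h →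
      SetCapacity.IsRealStable h →
        SetCapacity.cap B g * SetCapacity.lowerCap (SetCapacity.dualFamily B) h
            * ((m.factorial : ℝ) / (m : ℝ) ^ m) / c ≤ SetCapacity.familyCoeff B g ∧
        (SetCapacity.IsMultiaffine g → SetCapacity.IsMultiaffine h →
          SetCapacity.cap B g * SetCapacity.lowerCap (SetCapacity.dualFamily B) h
            * (1 / (2 : ℝ) ^ m) / c ≤ SetCapacity.familyCoeff B g)) := by
  refine ⟨hg_nonneg.familyCoeff_le_cap B, fun h hh hhs => ?_, fun c hc h hh hhs => ?_⟩
  · have happrox := hh.isApproxSelection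
    refine ⟨?_, fun hgm hhm => ?_⟩
    · simpa only [div_one] using happrox.cap_mul_lowerCap_mul_factorial_div_le
        hhs one_pos hB hg_nonneg hg_stable hg_hom
    · simpa only [div_one] using happrox.cap_mul_lowerCap_mul_two_pow_div_le
        hhs hhm one_pos hB hg_nonneg hg_stable hg_hom hgm
  · have hc_pos : 0 < c := zero_lt_one.trans_le hc
    exact ⟨hh.cap_mul_lowerCap_mul_factorial_div_le hhs hc_pos hB hg_nonneg hg_stable hg_hom,
      fun hgm hhm => hh.cap_mul_lowerCap_mul_two_pow_div_le
        hhs hhm hc_pos hB hg_nonneg hg_stable hg_hom hgm⟩
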